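/- Let $n\ge 2$, let $\mathcal H$ be a complex Hilbert space, and let $T=(T_1,\dots,T_n)$ be a doubly twisted isometry on $\mathcal H$ with respect to commuting unitaries $\{U_{ij}\}_{1\le i<j\le n}$: every $T_i$ is an isometry, and for all $i<j$ and all $k$, $T_i^*T_j=U_{ij}^*T_jT_i^*$ and $T_kU_{ij}=U_{ij}T_k$. Put $U_{ji}=U_{ij}^*$ for $i<j$. For $A=\{a_1<\dots<a_m\}\subseteq I_n=\{1,\dots,n\}$ and $k\in\mathbb N_0^m$ write $T_A^k=T_{a_1}^{k_1}\cdots T_{a_m}^{k_m}$, and let $\mathcal D_A=\bigcap_{\ell\in\mathbb N_0^{n-m}}T_{I_n\setminus A}^{\ell}\big(\bigcap_{i\in A}\ker T_i^*\big)$, where the intersection over $i\in A$ is $\mathcal H$ if $A=\emptyset$. Let $H^2_{\mathcal D_A}(\mathbb D^{m})$ be the $\mathcal D_A$-valued Hardy space over the polydisc, that is, the functions $f(z)=\sum_{k\in\mathbb N_0^m}z^k\eta_k$ with $\eta_k\in\mathcal D_A$ and $\|f\|^2=\sum_k\|\eta_k\|^2<\infty$ (for $A=\emptyset$ this is $\mathcal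 D_\emptyset$). Let $\Lambda_{A,k}:\mathcal D_A\to T_A^k\mathcal D_A$ be the unitary factor in the polar decomposition of $T_A^k:\mathcal D_A\to T_A^k\mathcal D_A$. Then for every $A\subseteq I_n$ there are bounded operators $M_{A,1},\dots,M_{A,n}$ on $H^2_{\mathcal D_A}(\mathbb D^{|A|})$ such that, for all $k\in\mathbb N_0^{m}$ and $\eta\in\mathcal D_A$, $$M_{A,a_i}(z^k\eta)=z^{k+e_i}\,U_{a_ia_1}^{k_1}\cdots U_{a_ia_{i-1}}^{k_{i-1}}\eta\qquad(1\le i\le m),$$ $$M_{A,q}(z^k\eta)=z^k\,U_{qa_1}^{k_1}\cdots U_{qa_m}^{k_m}T_q\eta\qquad(q\in I_n\setminus A),$$ where the weights map $\mathcal D_A$ into $\mathcal D_A$, and $T$ is unitarily equivalent to $(M_{T,1},\dots,M_{T,n})$ with $M_{T,s}=\bigoplus_{A\subseteq I_n}M_{A,s}$ on $\bigoplus_{A\subseteq I_n}H^2_{\mathcal D_A}(\mathbb D^{|A|})$: there is one unitary $V:\mathcal H\to\bigoplus_{A}H^2_{\mathcal D_A}(\mathbb D^{|A|})$ with $VT_s=M_{T,s}V$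 for all $s$. Moreover $V$ can be chosen so that it maps $\Lambda_{A,k}\eta$ to $z^k\eta$ in the summand of $A$, and the weights above are those of the model defined by the $\Lambda_{A,k}$: $$T_{a_i}\Lambda_{A,k}=\Lambda_{A,k+e_i}U_{a_ia_1}^{k_1}\cdots U_{a_ia_{i-1}}^{k_{i-1}},\qquad T_q\Lambda_{A,k}=\Lambda_{A,k}U_{qa_1}^{k_1}\cdots U_{qa_m}^{k_m}T_q\quad\text{on }\mathcal D_A .$$ -/

import Mathlib

open scoped InnerProductSpace

noncomputable section

/-! ### The vector-valued Hardy space over the polydisc -/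

/-- The monomial `z ^ k = z₁ ^ k₁ ⋯ z_m ^ k_m` at a point of the open unit polydisc. -/
def polydiscMonomial {m : ℕ} (k : Fin m → ℕ) (z : Fin m → Complex.UnitDisc) : ℂ :=
  ∏ i, (z i : ℂ) ^ k i

/-- `f` is the sum on the whole open polydisc of the power series with coefficients `a`. -/
def HasPowerSeries {m : ℕ} {E : Type*} [NormedAddCommGroup E] [InnerProductSpace ℂ E]
    (a : (Fin m → ℕ) → E) (f : (Fin m → Complex.UnitDisc) → E) : Prop :=
  ∀ z, HasSum (fun k => polydiscMonomial k z • a k) (f z)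

theorem powerSeries_coeff_eq_zero_one {g : ℕ → ℂ}
    (h : ∀ t : Complex.UnitDisc, HasSum (fun j => (t : ℂ) ^ j * g j) 0) : g = 0 := by
  let p : FormalMultilinearSeries ℂ ℂ ℂ :=
    fun j => ContinuousMultilinearMap.mkPiRing ℂ (Fin j) (g j)
  have hp : ∀ j, p.coeff j = g j := fun j => by
    simp [p, FormalMultilinearSeries.coeff]
  have h1 : HasFPowerSeriesAt (0 : ℂ → ℂ) p 0 := by
    refine hasFPowerSeriesAt_iff.mpr ?_
    filter_upwards [Metric.ball_mem_nhds (0 : ℂ) one_pos] with t ht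
    have ht' : ‖t‖ < 1 := by simpa using ht
    simpa [hp, smul_eq_mul] using h (Complex.UnitDisc.mk t ht')
  funext j
  rw [← hp j, h1.eq_zero]
  simp [FormalMultilinearSeries.coeff]

theorem powerSeries_slice_eq_zero {K : Type*} {d : ℕ → K → ℂ}
    (h : ∀ t : Complex.UnitDisc,
      HasSum (fun p : ℕ × K => (t : ℂ) ^ p.1 * d p.1 p.2) 0) (j : ℕ) :
    HasSum (d j) 0 := by
  obtain ⟨t, ht⟩ : ∃ t : Complex.UnitDisc, (t : ℂ) ≠ 0 :=
    ⟨Complex.UnitDisc.mk (1 / 2 : ℂ) (by norm_num), by simp⟩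
  have hs : ∀ j, Summable (d j) := by
    intro j
    exact (summable_mul_left_iff (pow_ne_zero j ht)).mp ((h t).summable.prod_factor j)
  have h3 : (fun j => ∑' k, d j k) = 0 :=
    powerSeries_coeff_eq_zero_one fun t =>
      (h t).prod_fiberwise (g := fun j => (t : ℂ) ^ j * ∑' k, d j k) fun j =>
        (hs j).hasSum.mul_left ((t : ℂ) ^ j)
  have h4 := (hs j).hasSum
  rwa [show ∑' k, d j k = 0 from congrFun h3 j] at h4

theorem powerSeries_coeff_eq_zero_scalar {m : ℕ} {c : (Fin m → ℕ) → ℂ}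
    (h : ∀ z, HasSum (fun k => polydiscMonomial k z * c k) 0) : c = 0 := by
  induction m with
  | zero =>
    funext k
    have h1 := (hasSum_unique (fun k => polydiscMonomial k Fin.elim0 * c k)).unique
      (h Fin.elim0)
    rw [Subsingleton.elim k (@default (Fin 0 → ℕ) Unique.instInhabited)]
    change c _ = (0 : ℂ)
    simpa only [polydiscMonomial, Finset.univ_eq_empty, Finset.prod_empty, one_mul] using h1
  | succ m ih =>
    have h2 : ∀ j, (fun k : Fin m → ℕ => c (Fin.cons j k)) = 0 := by
      intro j
      refine ih fun w => ?_
      refine powerSeries_slice_eq_zero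
        (d := fun j k => polydiscMonomial k w * c (Fin.cons j k)) (fun t => ?_) j
      have h1 := (Fin.consEquiv (fun _ : Fin (m + 1) => ℕ)).hasSum_iff.mpr (h (Fin.cons t w))
      convert h1 using 1
      funext p
      simp [polydiscMonomial, Fin.prod_univ_succ, Fin.consEquiv, mul_assoc]
    funext k
    have h6 := congrFun (h2 (k 0)) (Fin.tail k)
    simpa using h6

theorem HasPowerSeries.unique {m : ℕ} {E : Type*} [NormedAddCommGroup E] [InnerProductSpace ℂ E]
    {a b : (Fin m → ℕ) → E} {f : (Fin m → Complex.UnitDisc) → E}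
    (ha : HasPowerSeries a f) (hb : HasPowerSeries b f) : a = b := by
  have h : ∀ v : E, (fun k => ⟪v, a k - b k⟫_ℂ) = 0 := by
    intro v
    apply powerSeries_coeff_eq_zero_scalar
    intro z
    have h1 := ((ha z).sub (hb z)).mapL (innerSL ℂ v)
    simpa [inner_sub_right, inner_smul_right, mul_sub] using h1
  funext k
  have h1 := congrFun (h (a k - b k)) k
  exact sub_eq_zero.mp (inner_self_eq_zero.mp h1)

theorem HasPowerSeries.add {m : ℕ} {E : Type*} [NormedAddCommGroup E] [InnerProductSpace ℂ E]
    {a b : (Fin m → ℕ) → E} {f g : (Fin m → Complex.UnitDisc) → E}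
    (ha : HasPowerSeries a f) (hb : HasPowerSeries b g) :
    HasPowerSeries (a + b) (f + g) := by
  intro z
  simpa [smul_add] using (ha z).add (hb z)

theorem HasPowerSeries.smul {m : ℕ} {E : Type*} [NormedAddCommGroup E] [InnerProductSpace ℂ E]
    {a : (Fin m → ℕ) → E} {f : (Fin m → Complex.UnitDisc) → E} (c : ℂ)
    (ha : HasPowerSeries a f) : HasPowerSeries (c • a) (c • f) := by
  intro z
  simpa only [Pi.smul_apply, smul_comm c] using (ha z).const_smul c

/-- The functions `f(z) = ∑ₖ zᵏ aₖ` on the polydisc `𝔻ᵐ` with values in `E` whose coefficients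
satisfy `∑ₖ ‖aₖ‖² < ∞`. -/
def hardySubmodule (m : ℕ) (E : Type*) [NormedAddCommGroup E] [InnerProductSpace ℂ E] :
    Submodule ℂ ((Fin m → Complex.UnitDisc) → E) where
  carrier := {f | ∃ a : lp (fun _ : Fin m → ℕ => E) 2, HasPowerSeries (fun k => a k) f}
  add_mem' := by
    rintro f g ⟨a, ha⟩ ⟨b, hb⟩
    exact ⟨a + b, ha.add hb⟩
  zero_mem' := ⟨0, fun z => by simp⟩
  smul_mem' := by
    rintro c f ⟨a, ha⟩
    exact ⟨c • a, ha.smul c⟩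

/-- The `E`-valued Hardy space `H²_E(𝔻ᵐ)` over the polydisc. -/
def Hardy (m : ℕ) (E : Type*) [NormedAddCommGroup E] [InnerProductSpace ℂ E] : Type _ :=
  hardySubmodule m E

namespace Hardy

variable {m : ℕ} {E : Type*} [NormedAddCommGroup E] [InnerProductSpace ℂ E]

instance : AddCommGroup (Hardy m E) := inferInstanceAs (AddCommGroup (hardySubmodule m E))

instance : Module ℂ (Hardy m E) := inferInstanceAs (Module ℂ (hardySubmodule m E))

/-- The values of an element of the Hardy space on the polydisc. -/
def toFun (f : Hardy m E) : (Fin m → Complex.UnitDisc) → E := f.1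

/-- The sequence of Taylor coefficients. -/
def coeff (f : Hardy m E) : lp (fun _ : Fin m → ℕ => E) 2 := f.2.choose

theorem hasPowerSeries (f : Hardy m E) : HasPowerSeries (fun k => f.coeff k) f.toFun :=
  f.2.choose_spec

theorem coeff_eq {f : Hardy m E} {a : lp (fun _ : Fin m → ℕ => E) 2}
    (h : HasPowerSeries (fun k => a k) f.toFun) : f.coeff = a :=
  lp.ext (f.hasPowerSeries.unique h)

/-- Taylor coefficients as a linear map. -/
def coeffₗ : Hardy m E →ₗ[ℂ] lp (fun _ : Fin m → ℕ => E) 2 where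
  toFun := coeff
  map_add' f g := coeff_eq (f.hasPowerSeries.add g.hasPowerSeries)
  map_smul' c f := coeff_eq (f.hasPowerSeries.smul c)

theorem coeffₗ_injective : Function.Injective (coeffₗ : Hardy m E →ₗ[ℂ] _) := by
  intro f g h
  have h' : f.coeff = g.coeff := h
  refine Subtype.ext (funext fun z => ?_)
  have h1 := f.hasPowerSeries z
  rw [h'] at h1
  exact h1.unique (g.hasPowerSeries z)

/-- The norm is `‖f‖² = ∑ₖ ‖aₖ‖²`. -/
instance : NormedAddCommGroup (Hardy m E) :=
  NormedAddCommGroup.induced (Hardy m E) (lp (fun _ : Fin m → ℕ => E) 2) coeffₗ coeffₗ_injective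

/-- The inner product is `⟪f, g⟫ = ∑ₖ ⟪aₖ, bₖ⟫`. -/
instance : InnerProductSpace ℂ (Hardy m E) where
  norm_smul_le c f := by
    change ‖coeffₗ (c • f)‖ ≤ ‖c‖ * ‖coeffₗ f‖
    rw [map_smul]
    exact norm_smul_le c _
  inner f g := ⟪coeffₗ f, coeffₗ g⟫_ℂ
  norm_sq_eq_re_inner f := norm_sq_eq_re_inner (𝕜 := ℂ) (coeffₗ f)
  conj_inner_symm f g := inner_conj_symm (𝕜 := ℂ) (coeffₗ f) (coeffₗ g)
  add_left f g h := by simp only [map_add, inner_add_left]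
  smul_left f g c := by simp only [map_smul, inner_smul_left]

/-- The function `z ↦ zᵏ η` (identified with the elementary tensor `zᵏ ⊗ η`). -/
def monomial (k : Fin m → ℕ) (η : E) : Hardy m E :=
  ⟨fun z => polydiscMonomial k z • η, lp.single 2 k η, fun z => by
    have h := hasSum_single (f := fun l => polydiscMonomial l z •
      (lp.single 2 k η : lp (fun _ : Fin m → ℕ => E) 2) l) k (fun l hl => by
        simp [lp.single_apply, Pi.single_eq_of_ne hl])
    simpa [lp.single_apply] using h⟩

end Hardy

/-! ### Doubly twisted isometries -/

variable {n : ℕ} {H : Type*} [NormedAddCommGroup H] [InnerProductSpace ℂ H]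

/-- `T = (T₁, …, Tₙ)` is a doubly twisted isometry with respect to the commuting unitaries
`U i j`, `i < j`. Only the entries of `U` with `i < j` are used. -/
structure IsDoublyTwistedIsometry [CompleteSpace H] (T : Fin n → H →L[ℂ] H)
    (U : Fin n → Fin n → H →L[ℂ] H) : Prop where
  isometry : ∀ i, Isometry (T i)
  unitary : ∀ i j, i < j → U i j ∈ unitary (H →L[ℂ] H)
  commute_unitary : ∀ i j p q, i < j → p < q → Commute (U i j) (U p q)
  commute : ∀ k i j, i < j → Commute (T k) (U i j)
  twist : ∀ i j, i < j → star (T i) * T j = star (U i j) * T j * star (T i)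

/-- The family of unitaries extended to all `i ≠ j` by `U j i = (U i j)*` for `i < j`. -/
def twistExt [CompleteSpace H] (U : Fin n → Fin n → H →L[ℂ] H) (i j : Fin n) : H →L[ℂ] H :=
  if i < j then U i j else star (U j i)

/-- The elements `a₁ < ⋯ < a_m` of `A`, in increasing order. -/
def elt (A : Finset (Fin n)) (i : Fin A.card) : Fin n := A.orderEmbOfFin rfl i

/-- The ordered product `T_A^k = T_{a₁}^{k₁} ⋯ T_{a_m}^{k_m}`. -/
def opPow (T : Fin n → H →L[ℂ] H) (A : Finset (Fin n)) (k : Fin A.card → ℕ) : H →L[ℂ] H :=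
  (List.ofFn fun i => T (elt A i) ^ k i).prod

/-- `W_A`, the intersection of the kernels of `T_i*`, `i ∈ A`; it is `H` for `A = ∅`. -/
def wanderingKer [CompleteSpace H] (T : Fin n → H →L[ℂ] H) (A : Finset (Fin n)) :
    Submodule ℂ H :=
  ⨅ i ∈ A, LinearMap.ker (star (T i) : H →L[ℂ] H).toLinearMap

/-- The `A`-wandering subspace `D_A`, the intersection over all `ℓ` of `T_{Aᶜ}^ℓ W_A`. -/
def wandering [CompleteSpace H] (T : Fin n → H →L[ℂ] H) (A : Finset (Fin n)) :
    Submodule ℂ H :=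
  ⨅ l : Fin (Aᶜ).card → ℕ, (wanderingKer T A).map (opPow T Aᶜ l).toLinearMap

/-- `U_{a_i a_1}^{k_1} ⋯ U_{a_i a_{i-1}}^{k_{i-1}}`. -/
def shiftWeight [CompleteSpace H] (U : Fin n → Fin n → H →L[ℂ] H) (A : Finset (Fin n))
    (i : Fin A.card) (k : Fin A.card → ℕ) : H →L[ℂ] H :=
  (List.ofFn fun j : Fin i =>
    twistExt U (elt A i) (elt A (j.castLE i.isLt.le)) ^ k (j.castLE i.isLt.le)).prod

/-- `U_{q a_1}^{k_1} ⋯ U_{q a_m}^{k_m} T_q`. -/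
def diagWeight [CompleteSpace H] (T : Fin n → H →L[ℂ] H) (U : Fin n → Fin n → H →L[ℂ] H)
    (A : Finset (Fin n)) (q : Fin n) (k : Fin A.card → ℕ) : H →L[ℂ] H :=
  (List.ofFn fun j => twistExt U q (elt A j) ^ k j).prod * T q

/-- `Λ : D → S(D)` is the unitary factor in the polar decomposition `S = Λ P` of the
(injective) operator `S : D → S(D)`, with `P` positive on `D`. -/
def IsPolarUnitary (S : H →L[ℂ] H) (D : Submodule ℂ H)
    (Λ : D ≃ₗᵢ[ℂ] D.map S.toLinearMap) : Prop :=
  ∃ P : D →L[ℂ] D, P.IsPositive ∧ ∀ η : D, (Λ (P η) : H) = S η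

/-- The space `⨁_A H²_{D_A}(𝔻^{|A|})`, a Hilbert space direct sum over all `A ⊆ {1, …, n}`. -/
abbrev ModelSpace [CompleteSpace H] (T : Fin n → H →L[ℂ] H) : Type _ :=
  PiLp 2 fun A : Finset (Fin n) => Hardy A.card (wandering T A)

end

/-!
For `i ≠ j` the isometries `P = T_i T_j` and `Q = U_{ij} T_j T_i` satisfy `P* Q = 1`, hence are
equal. By these relations `T_{a_i}` maps `T_A^k D_A` onto `T_A^{k + e_i} D_A`, and `T_q` with
`q ∉ A` maps it onto itself. Two of these spaces with the same `A` and `k_i < l_i` are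
orthogonal because, for `S = T_{a_i}`, the first lies in `S^{k_i} (ker S*)` and the second in the
range of `S^{l_i}`. If `q ∈ A \ B`, then `T_A^k D_A` lies in `T_q^r (ker T_q*)` for some `r`, while
`T_B^l D_B` lies in the range of every power of `T_q`.

The sum of all these spaces is dense because its orthogonal complement `K` is reducing. If `K ≠ 0`,
choose `A` maximal with `K ∩ W_A ≠ 0`; then `T_q T_q*` is the identity on `K ∩ W_A` for `q ∉ A`,
whence `0 ≠ K ∩ W_A ⊆ D_A`, a contradiction. Since every `T_A^k` is isometric, sending `T_A^k η`
to `z^k η` for all `A`, `k` and `η ∈ D_A` extends to a unitary onto the model space.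
-/

section OrderedPow

variable {M : Type*} [Monoid M] {m : ℕ} {a w : Fin m → M} {k : Fin m → ℕ} {b : M}

/-- The ordered product `a₀ ^ k₀ ⋯ a_{m-1} ^ k_{m-1}`. The operators `opPow`, `shiftWeight` and the
unitary factor of `diagWeight` are by definition of this form. -/
def orderedPow (a : Fin m → M) (k : Fin m → ℕ) : M :=
  (List.ofFn fun i => a i ^ k i).prod

theorem orderedPow_succ (a : Fin (m + 1) → M) (k : Fin (m + 1) → ℕ) :
    orderedPow a k = a 0 ^ k 0 * orderedPow (Fin.tail a) (Fin.tail k) := by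
  simp [orderedPow, List.ofFn_succ, Fin.tail]

theorem orderedPow_induction {p : M → Prop} (one : p 1) (mul : ∀ x y, p x → p y → p (x * y))
    (base : ∀ i, k i ≠ 0 → p (a i)) : p (orderedPow a k) := by
  have pow : ∀ i r, (r ≠ 0 → p (a i)) → p (a i ^ r) := by
    intro i r
    induction r with
    | zero => simpa using one
    | succ r ih =>
      intro h
      rw [pow_succ]
      exact mul _ _ (ih fun _ => h r.succ_ne_zero) (h r.succ_ne_zero)
  refine List.prod_induction p mul one ?_
  simp only [List.mem_ofFn, forall_exists_index, forall_apply_eq_imp_iff]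
  exact fun i => pow i (k i) (base i)

theorem semiconjBy_orderedPow {a' : Fin m → M} (h : ∀ i, SemiconjBy b (a i) (a' i))
    (k : Fin m → ℕ) : SemiconjBy b (orderedPow a k) (orderedPow a' k) := by
  induction m with
  | zero => simp [orderedPow]
  | succ m ih =>
    rw [orderedPow_succ, orderedPow_succ]
    exact ((h 0).pow_right _).mul_right (ih (fun i => h i.succ) _)

theorem commute_orderedPow (h : ∀ i, Commute b (a i)) (k : Fin m → ℕ) :
    Commute b (orderedPow a k) :=
  semiconjBy_orderedPow h k

theorem orderedPow_mul (h : ∀ i j, Commute (w i) (a j)) (k : Fin m → ℕ) :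
    orderedPow (fun i => w i * a i) k = orderedPow w k * orderedPow a k := by
  induction m with
  | zero => simp [orderedPow]
  | succ m ih =>
    have hcomm : Commute (a 0 ^ k 0) (orderedPow (Fin.tail w) (Fin.tail k)) :=
      commute_orderedPow (fun i => ((h i.succ 0).pow_right _).symm) _
    have hrest : orderedPow (Fin.tail fun i => w i * a i) (Fin.tail k) =
        orderedPow (Fin.tail w) (Fin.tail k) * orderedPow (Fin.tail a) (Fin.tail k) :=
      ih (fun i j => h i.succ j.succ) _
    rw [orderedPow_succ, orderedPow_succ w, orderedPow_succ a, (h 0 0).mul_pow, hrest, mul_assoc,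
      hcomm.left_comm, mul_assoc]

theorem mul_orderedPow (h : ∀ i, SemiconjBy b (a i) (w i * a i))
    (hw : ∀ i j, Commute (w i) (a j)) (k : Fin m → ℕ) :
    b * orderedPow a k = orderedPow a k * (orderedPow w k * b) := by
  have hcomm : Commute (orderedPow w k) (orderedPow a k) :=
    commute_orderedPow (fun j => (commute_orderedPow (fun i => (hw i j).symm) k).symm) k
  rw [(semiconjBy_orderedPow h k).eq, orderedPow_mul hw, hcomm.eq, mul_assoc]

theorem orderedPow_add_single_zero (a : Fin (m + 1) → M) (k : Fin (m + 1) → ℕ) :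
    orderedPow a (k + Pi.single 0 1) = a 0 * orderedPow a k := by
  have htail : Fin.tail (k + Pi.single 0 1) = Fin.tail k := by
    funext j
    simp [Fin.tail]
  simp [orderedPow_succ, htail, pow_succ', mul_assoc]

theorem orderedPow_add_single_succ (a : Fin (m + 1) → M) (k : Fin (m + 1) → ℕ) (i : Fin m) :
    orderedPow a (k + Pi.single i.succ 1) =
      a 0 ^ k 0 * orderedPow (Fin.tail a) (Fin.tail k + Pi.single i 1) := by
  have htail : Fin.tail (k + Pi.single i.succ 1) = Fin.tail k + Pi.single i 1 := by
    funext j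
    simp [Fin.tail, Pi.single_apply]
  simp [orderedPow_succ, htail]

/-- Only the factors to the left of the `i`-th one have to be passed. -/
theorem factor_mul_orderedPow (i : Fin m) {w : Fin i → M}
    (h : ∀ j, SemiconjBy (a i) (a (j.castLE i.isLt.le)) (w j * a (j.castLE i.isLt.le)))
    (hw : ∀ j l, Commute (w j) (a l)) (k : Fin m → ℕ) :
    a i * orderedPow a k =
      orderedPow a (k + Pi.single i 1) * orderedPow w fun j => k (j.castLE i.isLt.le) := by
  induction m with
  | zero => exact i.elim0
  | succ m ih =>
    cases i using Fin.cases with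
    | zero => exact (orderedPow_add_single_zero a k).symm.trans (mul_one _).symm
    | succ i =>
      change Fin (i + 1) → M at w
      have hw₀ : ∀ l, Commute (w 0) (a l) := hw (0 : Fin (i + 1))
      have hpass : a i.succ * a 0 ^ k 0 = w 0 ^ k 0 * a 0 ^ k 0 * a i.succ := by
        rw [← (hw₀ 0).mul_pow]
        exact ((h (0 : Fin (i + 1))).pow_right _).eq
      have hcomm : Commute (w 0 ^ k 0)
          (a 0 ^ k 0 * orderedPow (Fin.tail a) (Fin.tail k + Pi.single i 1)) :=
        ((hw₀ 0).pow_pow _ _).mul_right (commute_orderedPow (fun l => (hw₀ l.succ).pow_left _) _)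
      have hrest := ih (a := Fin.tail a) i (w := Fin.tail w) (fun j => h j.succ)
        (fun j l => hw j.succ l.succ) (Fin.tail k)
      calc a i.succ * orderedPow a k
        _ = w 0 ^ k 0 * a 0 ^ k 0 * (Fin.tail a i * orderedPow (Fin.tail a) (Fin.tail k)) := by
          rw [orderedPow_succ, ← mul_assoc, hpass, mul_assoc, Fin.tail]
        _ = a 0 ^ k 0 * orderedPow (Fin.tail a) (Fin.tail k + Pi.single i 1) * (w 0 ^ k 0 *
            orderedPow (Fin.tail w) fun j => Fin.tail k (j.castLE i.isLt.le)) := by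
          rw [hrest, ← mul_assoc, mul_assoc (w 0 ^ k 0), hcomm.eq, mul_assoc]
        _ = _ := by
          rw [orderedPow_add_single_succ]
          exact congrArg _ (orderedPow_succ w fun j => k (j.castLE i.succ.isLt.le)).symm

end OrderedPow

section CommutingUnitaries

variable {ι R : Type*} [Monoid R] [StarMul R] {T : ι → R} {u : R}

/-- The unitaries that commute with every `T s`. All the `U_{ij}` and their adjoints are among them,
and they map every subspace built from the `T s` alone onto itself. -/
def commutingUnitaries (T : ι → R) : Submonoid R :=
  unitary R ⊓ Submonoid.centralizer (Set.range T)

theorem mem_commutingUnitaries :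
    u ∈ commutingUnitaries T ↔ u ∈ unitary R ∧ ∀ s, Commute u (T s) := by
  simp only [commutingUnitaries, Submonoid.mem_inf, Submonoid.mem_centralizer_iff,
    Set.forall_mem_range]
  exact and_congr_right fun _ => forall_congr' fun s => eq_comm

theorem commute_of_mem_commutingUnitaries (hu : u ∈ commutingUnitaries T) (s : ι) :
    Commute u (T s) :=
  (mem_commutingUnitaries.1 hu).2 s

theorem star_mem_commutingUnitaries (hu : u ∈ commutingUnitaries T) :
    star u ∈ commutingUnitaries T := by
  obtain ⟨hu, hcomm⟩ := mem_commutingUnitaries.1 hu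
  refine mem_commutingUnitaries.2 ⟨Unitary.star_mem hu, fun s => ?_⟩
  rw [commute_unitary_iff_star_right_conjugate (Unitary.star_mem hu), star_star]
  exact (commute_unitary_iff_star_left_conjugate hu).1 (hcomm s)

theorem commute_star_of_mem_commutingUnitaries (hu : u ∈ commutingUnitaries T) (s : ι) :
    Commute u (star (T s)) :=
  commute_star_comm.1 (commute_of_mem_commutingUnitaries (star_mem_commutingUnitaries hu) s)

end CommutingUnitaries

section Isometry

theorem star_mul_mul_self_eq_one {R : Type*} [Monoid R] [StarMul R] {a b : R}
    (ha : star a * a = 1) (hb : star b * b = 1) : star (a * b) * (a * b) = 1 := by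
  rw [star_mul, mul_assoc, ← mul_assoc (star a), ha, one_mul, hb]

theorem eq_of_star_mul_eq_one {R : Type*} [NormedRing R] [StarRing R] [CStarRing R] {a b : R}
    (ha : star a * a = 1) (hb : star b * b = 1) (hab : star a * b = 1) : a = b := by
  have hba : star b * a = 1 := by simpa using congrArg star hab
  rw [← sub_eq_zero, ← CStarRing.star_mul_self_eq_zero_iff]
  simp [sub_mul, mul_sub, ha, hb, hab, hba]

theorem semiconjBy_of_star_mul_eq {R : Type*} [NormedRing R] [StarRing R] [CStarRing R] {a b u : R}
    (ha : star a * a = 1) (hb : star b * b = 1) (hu : u ∈ unitary R) (hua : Commute u (star a))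
    (h : star a * b = star u * b * star a) : SemiconjBy a b (u * b) := by
  refine eq_of_star_mul_eq_one (star_mul_mul_self_eq_one ha hb)
    (star_mul_mul_self_eq_one (star_mul_mul_self_eq_one (Unitary.star_mul_self_of_mem hu) hb) ha) ?_
  calc star (a * b) * (u * b * a)
    _ = star b * (star a * u) * b * a := by simp only [star_mul, mul_assoc]
    _ = star b * u * (star a * b) * a := by rw [← hua.eq]; simp only [mul_assoc]
    _ = star b * (u * star u) * b * (star a * a) := by rw [h]; simp only [mul_assoc]
    _ = 1 := by rw [Unitary.mul_star_self_of_mem hu, ha, mul_one, mul_one, hb]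

variable {𝕜 E : Type*} [RCLike 𝕜] [NormedAddCommGroup E] [InnerProductSpace 𝕜 E]

theorem map_mul_toLinearMap (K : Submodule 𝕜 E) (S R : E →L[𝕜] E) :
    K.map (S * R).toLinearMap = (K.map R.toLinearMap).map S.toLinearMap :=
  Submodule.map_comp _ _ K

theorem map_one_toLinearMap (K : Submodule 𝕜 E) : K.map (1 : E →L[𝕜] E).toLinearMap = K :=
  Submodule.map_id K

theorem isOrtho_topologicalClosure {K L : Submodule 𝕜 E} (h : K ⟂ L) :
    K.topologicalClosure ⟂ L.topologicalClosure := by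
  rw [Submodule.isOrtho_iff_le, L.orthogonal_closure]
  exact K.topologicalClosure_minimal h.le (Submodule.isClosed_orthogonal L)

variable [CompleteSpace E] {V : E →L[𝕜] E}

theorem injective_of_star_mul_self_eq_one (hV : star V * V = 1) : Function.Injective V :=
  Function.LeftInverse.injective (g := ⇑(star V)) fun x => DFunLike.congr_fun hV x

theorem inner_map_map_of_star_mul_self_eq_one (hV : star V * V = 1) (x y : E) :
    inner 𝕜 (V x) (V y) = inner 𝕜 x y :=
  (ContinuousLinearMap.inner_map_map_iff_adjoint_comp_self V).2 hV x y

theorem map_star_map_of_star_mul_self_eq_one (hV : star V * V = 1) (K : Submodule 𝕜 E) :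
    (K.map V.toLinearMap).map (star V).toLinearMap = K := by
  rw [← map_mul_toLinearMap, hV, map_one_toLinearMap]

theorem map_eq_self_of_mem_unitary (hV : V ∈ unitary (E →L[𝕜] E)) {K : Submodule 𝕜 E}
    (h : K.map V.toLinearMap ≤ K) (h' : K.map (star V).toLinearMap ≤ K) :
    K.map V.toLinearMap = K := by
  refine h.antisymm ?_
  conv_lhs => rw [← map_one_toLinearMap K, ← Unitary.mul_star_self_of_mem hV, map_mul_toLinearMap]
  exact Submodule.map_mono h'

theorem isOrtho_map_pow (hV : star V * V = 1) {K : Submodule 𝕜 E}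
    (hK : K ≤ LinearMap.ker (star V).toLinearMap) (L : Submodule 𝕜 E) {r s : ℕ} (hrs : r < s) :
    K.map (V ^ r).toLinearMap ⟂ L.map (V ^ s).toLinearMap := by
  obtain ⟨d, rfl⟩ := Nat.exists_eq_add_of_lt hrs
  have hpow : star (V ^ r) * V ^ r = 1 := by
    rw [star_pow]
    exact pow_mul_pow_eq_one r hV
  rw [Submodule.isOrtho_iff_inner_eq]
  rintro _ ⟨x, hx, rfl⟩ _ ⟨y, -, rfl⟩
  calc inner 𝕜 ((V ^ r) x) ((V ^ (r + d + 1)) y)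
    _ = inner 𝕜 ((V ^ r) x) ((V ^ r) (V ((V ^ d) y))) := by
      rw [add_assoc, pow_add, pow_succ']
      rfl
    _ = inner 𝕜 (star V x) ((V ^ d) y) := by
      rw [inner_map_map_of_star_mul_self_eq_one hpow, ContinuousLinearMap.star_eq_adjoint,
        ContinuousLinearMap.adjoint_inner_left]
    _ = 0 := by
      rw [show star V x = 0 from hK hx, inner_zero_left]

end Isometry

section Elt

variable {n : ℕ} {A : Finset (Fin n)} {q : Fin n}

theorem elt_injective (A : Finset (Fin n)) : Function.Injective (elt A) :=
  (A.orderEmbOfFin rfl).injective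

theorem elt_mem (A : Finset (Fin n)) (i : Fin A.card) : elt A i ∈ A :=
  A.orderEmbOfFin_mem rfl i

theorem exists_elt_eq (hq : q ∈ A) : ∃ i, elt A i = q := by
  rwa [← Finset.mem_coe, ← A.range_orderEmbOfFin rfl] at hq

theorem ne_elt_of_notMem (hq : q ∉ A) (j : Fin A.card) : q ≠ elt A j :=
  fun h => hq (h ▸ elt_mem A j)

theorem opPow_zero {H : Type*} [NormedAddCommGroup H] [InnerProductSpace ℂ H]
    (T : Fin n → H →L[ℂ] H) (A : Finset (Fin n)) : opPow T A 0 = 1 := by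
  simp [opPow, List.ofFn_const]

end Elt

namespace IsDoublyTwistedIsometry

variable {n : ℕ} {H : Type*} [NormedAddCommGroup H] [InnerProductSpace ℂ H] [CompleteSpace H]
  {T : Fin n → H →L[ℂ] H} {U : Fin n → Fin n → H →L[ℂ] H} (hT : IsDoublyTwistedIsometry T U)
  {A : Finset (Fin n)} {i j q : Fin n}

include hT

theorem star_mul_self (i : Fin n) : star (T i) * T i = 1 :=
  (T i).isometry_iff_adjoint_comp_self.1 (hT.isometry i)

theorem star_opPow_mul_opPow (A : Finset (Fin n)) (k : Fin A.card → ℕ) :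
    star (opPow T A k) * opPow T A k = 1 :=
  orderedPow_induction (p := fun V => star V * V = 1) (by simp)
    (fun _ _ => star_mul_mul_self_eq_one) fun _ _ => hT.star_mul_self _

theorem mem_commutingUnitaries (hij : i < j) : U i j ∈ commutingUnitaries T :=
  _root_.mem_commutingUnitaries.2 ⟨hT.unitary i j hij, fun s => (hT.commute s i j hij).symm⟩

theorem twistExt_mem (hij : i ≠ j) : twistExt U i j ∈ commutingUnitaries T := by
  rcases hij.lt_or_gt with h | h
  · simpa [twistExt, h] using hT.mem_commutingUnitaries h
  · simpa [twistExt, h.not_gt] using star_mem_commutingUnitaries (hT.mem_commutingUnitaries h)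

theorem star_mul_of_ne (hij : i ≠ j) :
    star (T i) * T j = star (twistExt U i j) * T j * star (T i) := by
  rcases hij.lt_or_gt with h | h
  · simpa [twistExt, h] using hT.twist i j h
  · have hU := hT.mem_commutingUnitaries h
    have hcomm : Commute (U j i) (T j * star (T i)) :=
      (commute_of_mem_commutingUnitaries hU j).mul_right
        (commute_star_of_mem_commutingUnitaries hU i)
    calc star (T i) * T j = star (star (T j) * T i) := by simp
      _ = T j * star (T i) * U j i := by rw [hT.twist j i h]; simp [mul_assoc]
      _ = star (twistExt U i j) * T j * star (T i) := by
        simp [← hcomm.eq, twistExt, h.not_gt, mul_assoc]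

theorem semiconjBy_twistExt (hij : i ≠ j) : SemiconjBy (T i) (T j) (twistExt U i j * T j) :=
  semiconjBy_of_star_mul_eq (hT.star_mul_self i) (hT.star_mul_self j)
    (_root_.mem_commutingUnitaries.1 (hT.twistExt_mem hij)).1
    (commute_star_of_mem_commutingUnitaries (hT.twistExt_mem hij) i) (hT.star_mul_of_ne hij)

theorem shiftWeight_mem (A : Finset (Fin n)) (i : Fin A.card) (k : Fin A.card → ℕ) :
    shiftWeight U A i k ∈ commutingUnitaries T :=
  orderedPow_induction (p := (· ∈ commutingUnitaries T)) (one_mem _) (fun _ _ => mul_mem)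
    fun j _ => hT.twistExt_mem ((elt_injective A).ne (Fin.ne_of_gt j.isLt))

theorem mul_opPow_of_mem (A : Finset (Fin n)) (i : Fin A.card) (k : Fin A.card → ℕ) :
    T (elt A i) * opPow T A k = opPow T A (k + Pi.single i 1) * shiftWeight U A i k := by
  have hne : ∀ j : Fin i, elt A i ≠ elt A (j.castLE i.isLt.le) :=
    fun j => (elt_injective A).ne (Fin.ne_of_gt j.isLt)
  exact factor_mul_orderedPow (a := fun i => T (elt A i)) i
    (fun j => hT.semiconjBy_twistExt (hne j))
    (fun j _ => commute_of_mem_commutingUnitaries (hT.twistExt_mem (hne j)) _) k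

theorem mul_opPow_of_notMem (hq : q ∉ A) (k : Fin A.card → ℕ) :
    T q * opPow T A k = opPow T A k * diagWeight T U A q k :=
  mul_orderedPow (fun j => hT.semiconjBy_twistExt (ne_elt_of_notMem hq j))
    (fun j _ => commute_of_mem_commutingUnitaries (hT.twistExt_mem (ne_elt_of_notMem hq j)) _) k

theorem exists_semiconjBy (q s : Fin n) :
    ∃ w ∈ commutingUnitaries T, SemiconjBy (T q) (T s) (w * T s) := by
  rcases eq_or_ne q s with rfl | hqs
  · exact ⟨1, one_mem _, by simp [SemiconjBy]⟩
  · exact ⟨_, hT.twistExt_mem hqs, hT.semiconjBy_twistExt hqs⟩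

theorem exists_mul_opPow_eq (q : Fin n) (A : Finset (Fin n)) (k : Fin A.card → ℕ) :
    ∃ w ∈ commutingUnitaries T, T q * opPow T A k = opPow T A k * (w * T q) := by
  choose w hw hsemi using hT.exists_semiconjBy q
  exact ⟨orderedPow (fun i => w (elt A i)) k,
    orderedPow_induction (p := (· ∈ commutingUnitaries T)) (one_mem _) (fun _ _ => mul_mem)
      fun i _ => hw _,
    mul_orderedPow (fun i => hsemi _) (fun i _ => commute_of_mem_commutingUnitaries (hw _) _) k⟩

end IsDoublyTwistedIsometry

section Wandering

variable {n : ℕ} {H : Type*} [NormedAddCommGroup H] [InnerProductSpace ℂ H] [CompleteSpace H]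
  {T : Fin n → H →L[ℂ] H} {A : Finset (Fin n)} {S W : H →L[ℂ] H}

theorem mem_wanderingKer {x : H} : x ∈ wanderingKer T A ↔ ∀ i ∈ A, star (T i) x = 0 := by
  simp [wanderingKer, Submodule.mem_iInf]

theorem wanderingKer_singleton (T : Fin n → H →L[ℂ] H) (i : Fin n) :
    wanderingKer T {i} = LinearMap.ker (star (T i) : H →L[ℂ] H).toLinearMap := by
  simp [wanderingKer]

theorem wanderingKer_antitone (T : Fin n → H →L[ℂ] H) : Antitone (wanderingKer T) :=
  fun _ _ h => biInf_mono h

theorem wandering_le_map_opPow (l : Fin (Aᶜ).card → ℕ) :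
    wandering T A ≤ (wanderingKer T A).map (opPow T Aᶜ l).toLinearMap :=
  iInf_le _ l

theorem wandering_le_wanderingKer : wandering T A ≤ wanderingKer T A := by
  simpa only [opPow_zero, map_one_toLinearMap] using wandering_le_map_opPow (T := T) (A := A) 0

theorem le_wandering {K : Submodule ℂ H} (hK : K ≤ wanderingKer T A)
    (h : ∀ q ∉ A, K ≤ K.map (T q).toLinearMap) : K ≤ wandering T A := by
  refine le_iInf fun l => le_trans ?_ (Submodule.map_mono hK)
  refine orderedPow_induction (p := fun V : H →L[ℂ] H => K ≤ K.map V.toLinearMap)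
    (map_one_toLinearMap K).ge (fun V V' hV hV' => ?_)
    fun i _ => h _ (Finset.mem_compl.1 (elt_mem Aᶜ i))
  rw [map_mul_toLinearMap]
  exact hV.trans (Submodule.map_mono hV')

theorem map_wanderingKer_le (h : ∀ i ∈ A, ∃ R, star (T i) * S = R * star (T i)) :
    (wanderingKer T A).map S.toLinearMap ≤ wanderingKer T A := by
  rintro _ ⟨x, hx, rfl⟩
  refine mem_wanderingKer.2 fun i hi => ?_
  obtain ⟨R, hR⟩ := h i hi
  calc star (T i) (S x) = R (star (T i) x) := DFunLike.congr_fun hR x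
    _ = 0 := by rw [mem_wanderingKer.1 hx i hi, map_zero]

theorem map_wanderingKer (hW : W ∈ commutingUnitaries T) :
    (wanderingKer T A).map W.toLinearMap = wanderingKer T A := by
  have hle {V} (hV : V ∈ commutingUnitaries T) :
      (wanderingKer T A).map V.toLinearMap ≤ wanderingKer T A :=
    map_wanderingKer_le fun i _ => ⟨V, (commute_star_of_mem_commutingUnitaries hV i).eq.symm⟩
  exact map_eq_self_of_mem_unitary (mem_commutingUnitaries.1 hW).1 (hle hW)
    (hle (star_mem_commutingUnitaries hW))

theorem map_wandering_eq_iInf (hS : star S * S = 1) :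
    (wandering T A).map S.toLinearMap =
      ⨅ l : Fin (Aᶜ).card → ℕ, (wanderingKer T A).map (S * opPow T Aᶜ l).toLinearMap := by
  simp only [wandering, map_mul_toLinearMap]
  exact Submodule.map_iInf _ (injective_of_star_mul_self_eq_one hS)

theorem map_wandering (hW : W ∈ commutingUnitaries T) :
    (wandering T A).map W.toLinearMap = wandering T A := by
  have hcomm (l : Fin (Aᶜ).card → ℕ) : W * opPow T Aᶜ l = opPow T Aᶜ l * W :=
    commute_orderedPow (fun _ => commute_of_mem_commutingUnitaries hW _) l
  rw [map_wandering_eq_iInf (Unitary.star_mul_self_of_mem (mem_commutingUnitaries.1 hW).1)]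
  simp only [hcomm, map_mul_toLinearMap, map_wanderingKer hW, wandering]

namespace IsDoublyTwistedIsometry

variable {U : Fin n → Fin n → H →L[ℂ] H} (hT : IsDoublyTwistedIsometry T U) {q : Fin n}

include hT

theorem map_wanderingKer_le (hq : q ∉ A) :
    (wanderingKer T A).map (T q).toLinearMap ≤ wanderingKer T A :=
  _root_.map_wanderingKer_le fun _ hi => ⟨_, hT.star_mul_of_ne (ne_of_mem_of_not_mem hi hq)⟩

theorem map_opPow_wanderingKer_le {B : Finset (Fin n)} {k : Fin A.card → ℕ}
    (h : ∀ i, k i ≠ 0 → elt A i ∉ B) :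
    (wanderingKer T B).map (opPow T A k).toLinearMap ≤ wanderingKer T B := by
  refine orderedPow_induction
    (p := fun V : H →L[ℂ] H => (wanderingKer T B).map V.toLinearMap ≤ wanderingKer T B)
    (map_one_toLinearMap _).le (fun V V' hV hV' => ?_) fun i hi => hT.map_wanderingKer_le (h i hi)
  rw [map_mul_toLinearMap]
  exact (Submodule.map_mono hV').trans hV

theorem map_star_wanderingKer_le (A : Finset (Fin n)) (q : Fin n) :
    (wanderingKer T A).map (star (T q) : H →L[ℂ] H).toLinearMap ≤ wanderingKer T A := by
  refine _root_.map_wanderingKer_le fun i _ => ?_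
  obtain ⟨w, hw, hsemi⟩ := hT.exists_semiconjBy q i
  have hcomm := commute_star_of_mem_commutingUnitaries (star_mem_commutingUnitaries hw) i
  refine ⟨star (T q) * star w, ?_⟩
  calc star (T i) * star (T q) = star (T q * T i) := (star_mul _ _).symm
    _ = star (T q) * (star (T i) * star w) := by rw [hsemi.eq, star_mul, star_mul]
    _ = star (T q) * star w * star (T i) := by rw [← hcomm.eq, mul_assoc]

theorem map_wandering_of_notMem (hq : q ∉ A) :
    (wandering T A).map (T q).toLinearMap = wandering T A := by
  rw [map_wandering_eq_iInf (hT.star_mul_self q)]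
  refine le_antisymm (iInf_mono fun l => ?_) (le_iInf fun l => ?_)
  · obtain ⟨w, hw, hmul⟩ := hT.exists_mul_opPow_eq q Aᶜ l
    rw [hmul, map_mul_toLinearMap, map_mul_toLinearMap]
    refine Submodule.map_mono (le_of_le_of_eq ?_ (map_wanderingKer hw))
    exact Submodule.map_mono (hT.map_wanderingKer_le hq)
  · obtain ⟨j, rfl⟩ := exists_elt_eq (Finset.mem_compl.2 hq)
    rw [hT.mul_opPow_of_mem, map_mul_toLinearMap, map_wanderingKer (hT.shiftWeight_mem _ j l)]
    exact wandering_le_map_opPow _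

theorem map_diagWeight_wandering (hq : q ∉ A) (k : Fin A.card → ℕ) :
    (wandering T A).map (diagWeight T U A q k).toLinearMap = wandering T A := by
  have hprod : orderedPow (fun j => twistExt U q (elt A j)) k ∈ commutingUnitaries T :=
    orderedPow_induction (p := (· ∈ commutingUnitaries T)) (one_mem _) (fun _ _ => mul_mem)
      fun j _ => hT.twistExt_mem (ne_elt_of_notMem hq j)
  calc (wandering T A).map (diagWeight T U A q k).toLinearMap
    _ = ((wandering T A).map (T q).toLinearMap).map _ := map_mul_toLinearMap _ _ _
    _ = wandering T A := by rw [hT.map_wandering_of_notMem hq]; exact map_wandering hprod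

theorem isometry_opPow (A : Finset (Fin n)) (k : Fin A.card → ℕ) : Isometry (opPow T A k) :=
  (opPow T A k).isometry_iff_adjoint_comp_self.2 (hT.star_opPow_mul_opPow A k)

theorem isClosed_wandering (A : Finset (Fin n)) : IsClosed (wandering T A : Set H) := by
  have hker : IsClosed (wanderingKer T A : Set H) := by
    simp only [wanderingKer, Submodule.coe_iInf]
    exact isClosed_biInter fun i _ => (star (T i) : H →L[ℂ] H).isClosed_ker
  simp only [wandering, Submodule.coe_iInf]
  exact isClosed_iInter fun l => (hT.isometry_opPow Aᶜ l).isClosedEmbedding.isClosedMap _ hker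

end IsDoublyTwistedIsometry

/-- The subspaces `T_A^k D_A`, whose orthogonal sum over all `A` and `k` is the whole space. -/
noncomputable def woldSpace (T : Fin n → H →L[ℂ] H) (A : Finset (Fin n)) (k : Fin A.card → ℕ) :
    Submodule ℂ H :=
  (wandering T A).map (opPow T A k).toLinearMap

theorem woldSpace_zero : woldSpace T A 0 = wandering T A := by
  rw [woldSpace, opPow_zero, map_one_toLinearMap]

namespace IsDoublyTwistedIsometry

variable {U : Fin n → Fin n → H →L[ℂ] H} (hT : IsDoublyTwistedIsometry T U) {q : Fin n}

include hT

theorem map_woldSpace_of_notMem (hq : q ∉ A) (k : Fin A.card → ℕ) :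
    (woldSpace T A k).map (T q).toLinearMap = woldSpace T A k := by
  rw [woldSpace, ← map_mul_toLinearMap, hT.mul_opPow_of_notMem hq, map_mul_toLinearMap,
    hT.map_diagWeight_wandering hq]

theorem map_woldSpace_of_mem (i : Fin A.card) (k : Fin A.card → ℕ) :
    (woldSpace T A k).map (T (elt A i)).toLinearMap = woldSpace T A (k + Pi.single i 1) := by
  rw [woldSpace, ← map_mul_toLinearMap, hT.mul_opPow_of_mem, map_mul_toLinearMap,
    map_wandering (hT.shiftWeight_mem A i k), woldSpace]

theorem map_pow_woldSpace_of_notMem (hq : q ∉ A) (k : Fin A.card → ℕ) (r : ℕ) :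
    (woldSpace T A k).map (T q ^ r).toLinearMap = woldSpace T A k := by
  induction r with
  | zero => rw [pow_zero, map_one_toLinearMap]
  | succ r ih => rw [pow_succ', map_mul_toLinearMap, ih, hT.map_woldSpace_of_notMem hq]

theorem map_pow_woldSpace_of_mem (i : Fin A.card) (k : Fin A.card → ℕ) (r : ℕ) :
    (woldSpace T A k).map (T (elt A i) ^ r).toLinearMap = woldSpace T A (k + Pi.single i r) := by
  induction r with
  | zero => rw [pow_zero, map_one_toLinearMap, Pi.single_zero, add_zero]
  | succ r ih =>
    rw [pow_succ', map_mul_toLinearMap, ih, hT.map_woldSpace_of_mem, add_assoc, ← Pi.single_add]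

theorem woldSpace_eq_map_pow (i : Fin A.card) (k : Fin A.card → ℕ) :
    woldSpace T A k =
      (woldSpace T A (Function.update k i 0)).map (T (elt A i) ^ k i).toLinearMap := by
  rw [hT.map_pow_woldSpace_of_mem]
  congr 1
  funext j
  rcases eq_or_ne j i with rfl | hji <;> simp [*]

theorem woldSpace_le_ker_star {i : Fin A.card} {k : Fin A.card → ℕ} (hk : k i = 0) :
    woldSpace T A k ≤ LinearMap.ker (star (T (elt A i)) : H →L[ℂ] H).toLinearMap := by
  have hle : wandering T A ≤ wanderingKer T {elt A i} :=
    wandering_le_wanderingKer.trans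
      (wanderingKer_antitone T (Finset.singleton_subset_iff.2 (elt_mem A i)))
  have hne : ∀ j, k j ≠ 0 → elt A j ∉ ({elt A i} : Finset (Fin n)) := fun j hj =>
    Finset.notMem_singleton.2 ((elt_injective A).ne (ne_of_apply_ne k (hk ▸ hj)))
  rw [← wanderingKer_singleton]
  exact (Submodule.map_mono hle).trans (hT.map_opPow_wanderingKer_le hne)

theorem isOrtho_woldSpace_of_lt {i : Fin A.card} {k l : Fin A.card → ℕ} (hkl : k i < l i) :
    woldSpace T A k ⟂ woldSpace T A l := by
  rw [hT.woldSpace_eq_map_pow i k, hT.woldSpace_eq_map_pow i l]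
  exact isOrtho_map_pow (hT.star_mul_self _) (hT.woldSpace_le_ker_star (Function.update_self ..)) _
    hkl

theorem isOrtho_woldSpace {k l : Fin A.card → ℕ} (hkl : k ≠ l) :
    woldSpace T A k ⟂ woldSpace T A l := by
  obtain ⟨i, hi⟩ := Function.ne_iff.1 hkl
  rcases hi.lt_or_gt with h | h
  · exact hT.isOrtho_woldSpace_of_lt h
  · exact (hT.isOrtho_woldSpace_of_lt h).symm

theorem isOrtho_woldSpace_of_notMem {B : Finset (Fin n)} (hq : q ∈ A) (hq' : q ∉ B)
    (k : Fin A.card → ℕ) (l : Fin B.card → ℕ) : woldSpace T A k ⟂ woldSpace T B l := by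
  obtain ⟨i, rfl⟩ := exists_elt_eq hq
  rw [hT.woldSpace_eq_map_pow i k, ← hT.map_pow_woldSpace_of_notMem hq' l (k i + 1)]
  exact isOrtho_map_pow (hT.star_mul_self _) (hT.woldSpace_le_ker_star (Function.update_self ..)) _
    (k i).lt_succ_self

theorem isOrtho_woldSpace_of_ne {B : Finset (Fin n)} (hAB : A ≠ B) (k : Fin A.card → ℕ)
    (l : Fin B.card → ℕ) : woldSpace T A k ⟂ woldSpace T B l := by
  by_cases h : A ⊆ B
  · obtain ⟨q, hqB, hqA⟩ := Finset.not_subset.1 fun h' => hAB (h.antisymm h')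
    exact (hT.isOrtho_woldSpace_of_notMem hqB hqA l k).symm
  · obtain ⟨q, hqA, hqB⟩ := Finset.not_subset.1 h
    exact hT.isOrtho_woldSpace_of_notMem hqA hqB k l

end IsDoublyTwistedIsometry

end Wandering

section Reducing

variable {𝕜 E ι : Type*} [RCLike 𝕜] [NormedAddCommGroup E] [InnerProductSpace 𝕜 E]
  [CompleteSpace E] {T : ι → E →L[𝕜] E} {K : Submodule 𝕜 E}

/-- A subspace that is invariant under the operators `T s` and their adjoints. It is not required
to be closed. -/
def IsReducing (T : ι → E →L[𝕜] E) (K : Submodule 𝕜 E) : Prop :=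
  ∀ s, K ∈ Module.End.invtSubmodule (T s).toLinearMap ∧
    K ∈ Module.End.invtSubmodule (star (T s)).toLinearMap

theorem IsReducing.orthogonal (hK : IsReducing T K) : IsReducing T Kᗮ := by
  refine fun s => ⟨ContinuousLinearMap.orthogonal_mem_invtSubmodule (hK s).2,
    ContinuousLinearMap.orthogonal_mem_invtSubmodule ?_⟩
  rw [← ContinuousLinearMap.star_eq_adjoint, star_star]
  exact (hK s).1

end Reducing

section Totality

variable {n : ℕ} {H : Type*} [NormedAddCommGroup H] [InnerProductSpace ℂ H] [CompleteSpace H]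
  {T : Fin n → H →L[ℂ] H} {U : Fin n → Fin n → H →L[ℂ] H} {K : Submodule ℂ H}

/-- The algebraic sum of all the Wold spaces `T_A^k D_A`. -/
noncomputable def woldSpan (T : Fin n → H →L[ℂ] H) : Submodule ℂ H :=
  ⨆ (A : Finset (Fin n)) (k : Fin A.card → ℕ), woldSpace T A k

theorem woldSpace_le_woldSpan (A : Finset (Fin n)) (k : Fin A.card → ℕ) :
    woldSpace T A k ≤ woldSpan T :=
  le_iSup₂ (f := fun A k => woldSpace T A k) A k

theorem map_woldSpan_le {S : H →L[ℂ] H}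
    (h : ∀ A k, (woldSpace T A k).map S.toLinearMap ≤ woldSpan T) :
    (woldSpan T).map S.toLinearMap ≤ woldSpan T := by
  rw [woldSpan, Submodule.map_iSup]
  simp only [Submodule.map_iSup]
  exact iSup₂_le h

namespace IsDoublyTwistedIsometry

variable (hT : IsDoublyTwistedIsometry T U)

include hT

theorem exists_map_woldSpace_eq (s : Fin n) (A : Finset (Fin n)) (k : Fin A.card → ℕ) :
    ∃ l, (woldSpace T A k).map (T s).toLinearMap = woldSpace T A l := by
  by_cases hs : s ∈ A
  · obtain ⟨i, rfl⟩ := exists_elt_eq hs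
    exact ⟨_, hT.map_woldSpace_of_mem i k⟩
  · exact ⟨k, hT.map_woldSpace_of_notMem hs k⟩

theorem map_star_woldSpace_le (s : Fin n) (A : Finset (Fin n)) (k : Fin A.card → ℕ) :
    (woldSpace T A k).map (star (T s) : H →L[ℂ] H).toLinearMap ≤ woldSpan T := by
  by_cases hs : s ∈ A
  · obtain ⟨i, rfl⟩ := exists_elt_eq hs
    rcases hk : k i with _ | r
    · exact (LinearMap.le_ker_iff_map.1 (hT.woldSpace_le_ker_star hk)).trans_le bot_le
    · rw [hT.woldSpace_eq_map_pow i k, hk, pow_succ', map_mul_toLinearMap,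
        map_star_map_of_star_mul_self_eq_one (hT.star_mul_self _), hT.map_pow_woldSpace_of_mem]
      exact woldSpace_le_woldSpan A _
  · rw [← hT.map_woldSpace_of_notMem hs k,
      map_star_map_of_star_mul_self_eq_one (hT.star_mul_self s)]
    exact woldSpace_le_woldSpan A k

theorem isReducing_woldSpan : IsReducing T (woldSpan T) := by
  refine fun s => ⟨(Module.End.mem_invtSubmodule_iff_map_le _).2 (map_woldSpan_le fun A k => ?_),
    (Module.End.mem_invtSubmodule_iff_map_le _).2 (map_woldSpan_le (hT.map_star_woldSpace_le s))⟩
  obtain ⟨l, hl⟩ := hT.exists_map_woldSpace_eq s A k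
  rw [hl]
  exact woldSpace_le_woldSpan A l

/-- If `K ∩ W_A` is nonzero and `A` is maximal with this property, then the projection
`1 - T_q T_q*` onto `ker T_q*` vanishes on `K ∩ W_A` for `q ∉ A`, so that
`K ∩ W_A ⊆ T_q (K ∩ W_A)`. -/
theorem exists_inf_wandering_ne_bot (hK : IsReducing T K) (hne : K ≠ ⊥) :
    ∃ A, K ⊓ wandering T A ≠ ⊥ := by
  obtain ⟨A, -, hA, hmax⟩ := Finite.exists_le_maximal (p := fun A => K ⊓ wanderingKer T A ≠ ⊥)
    (a := ∅) (by simpa [wanderingKer] using hne)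
  refine ⟨A, ne_bot_of_le_ne_bot hA (le_inf inf_le_left (le_wandering inf_le_right ?_))⟩
  rintro q hq x ⟨hxK, hxA⟩
  have hyK : star (T q) x ∈ K := (hK q).2 hxK
  have hyA : star (T q) x ∈ wanderingKer T A :=
    hT.map_star_wanderingKer_le A q (Submodule.mem_map_of_mem hxA)
  have hbot : K ⊓ wanderingKer T (insert q A) = ⊥ := by
    by_contra h
    exact hq (hmax h (Finset.subset_insert q A) (Finset.mem_insert_self q A))
  have hdiff : x - T q (star (T q) x) ∈ K ⊓ wanderingKer T (insert q A) := by
    refine ⟨sub_mem hxK ((hK q).1 hyK),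
      mem_wanderingKer.2 ((Finset.forall_mem_insert ..).2 ⟨?_, ?_⟩)⟩
    · have h := DFunLike.congr_fun (hT.star_mul_self q) (star (T q) x)
      exact (map_sub _ _ _).trans (sub_eq_zero.2 h.symm)
    · exact mem_wanderingKer.1 (sub_mem hxA
        (hT.map_wanderingKer_le hq (Submodule.mem_map_of_mem hyA)))
  rw [hbot, Submodule.mem_bot, sub_eq_zero] at hdiff
  exact ⟨star (T q) x, ⟨hyK, hyA⟩, hdiff.symm⟩

theorem orthogonal_woldSpan : (woldSpan T)ᗮ = ⊥ := by
  by_contra hne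
  obtain ⟨A, hA⟩ := hT.exists_inf_wandering_ne_bot hT.isReducing_woldSpan.orthogonal hne
  have hle : wandering T A ≤ woldSpan T := woldSpace_zero.ge.trans (woldSpace_le_woldSpan A 0)
  refine hA (eq_bot_mono (inf_le_inf_left _ hle) ?_)
  rw [inf_comm, Submodule.inf_orthogonal_eq_bot]

theorem topologicalClosure_woldSpan : (woldSpan T).topologicalClosure = ⊤ :=
  Submodule.topologicalClosure_eq_top_iff.2 hT.orthogonal_woldSpan

end IsDoublyTwistedIsometry

end Totality

section HardyComplete

theorem summable_norm_polydiscMonomial {m : ℕ} (z : Fin m → Complex.UnitDisc) :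
    Summable fun k => ‖polydiscMonomial k z‖ := by
  induction m with
  | zero => exact (hasSum_unique _).summable
  | succ m ih =>
    rw [← (Fin.consEquiv fun _ : Fin (m + 1) => ℕ).summable_iff]
    have hgeom : Summable fun j : ℕ => ‖(z 0 : ℂ)‖ ^ j :=
      summable_geometric_of_lt_one (norm_nonneg _) (z 0).norm_lt_one
    convert hgeom.mul_of_nonneg (ih (Fin.tail z)) (fun _ => pow_nonneg (norm_nonneg _) _)
      (fun _ => norm_nonneg _) using 1
    funext p
    simp [polydiscMonomial, Fin.prod_univ_succ, Fin.consEquiv, Fin.tail]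

namespace Hardy

variable {m : ℕ} {E : Type*} [NormedAddCommGroup E] [InnerProductSpace ℂ E]

theorem coeff_monomial (k : Fin m → ℕ) (η : E) : (monomial k η).coeff = lp.single 2 k η := by
  refine coeff_eq fun z => ?_
  have h := hasSum_single (f := fun l => polydiscMonomial l z •
    (lp.single 2 k η : lp (fun _ : Fin m → ℕ => E) 2) l) k fun l hl => by
      simp [lp.single_apply, Pi.single_eq_of_ne hl]
  simpa [monomial, toFun, lp.single_apply] using h

variable [CompleteSpace E]

theorem coeffₗ_surjective : Function.Surjective (coeffₗ : Hardy m E →ₗ[ℂ] _) := by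
  intro a
  have ha (z) : Summable fun k => polydiscMonomial k z • a k := by
    refine ((summable_norm_polydiscMonomial z).mul_right ‖a‖).of_norm_bounded fun k => ?_
    rw [norm_smul]
    gcongr
    exact lp.norm_apply_le_norm two_ne_zero a k
  have hsum : HasPowerSeries (fun k => a k) fun z => ∑' k, polydiscMonomial k z • a k :=
    fun z => (ha z).hasSum
  exact ⟨⟨_, a, hsum⟩, coeff_eq hsum⟩

/-- Taylor coefficients as a unitary map of the Hardy space onto `ℓ²`. -/
noncomputable def coeffEquiv : Hardy m E ≃ₗᵢ[ℂ] lp (fun _ : Fin m → ℕ => E) 2 where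
  toLinearEquiv := LinearEquiv.ofBijective coeffₗ ⟨coeffₗ_injective, coeffₗ_surjective⟩
  norm_map' _ := rfl

theorem coeffEquiv_monomial (k : Fin m → ℕ) (η : E) :
    coeffEquiv (monomial k η) = lp.single 2 k η :=
  coeff_monomial k η

instance : CompleteSpace (Hardy m E) :=
  (coeffEquiv (m := m) (E := E)).toIsometryEquiv.completeSpace_iff.2 inferInstance

end Hardy

end HardyComplete

section Model

theorem orthogonalFamily_iff_pairwise_range {𝕜 E ι : Type*} [RCLike 𝕜] [NormedAddCommGroup E]
    [InnerProductSpace 𝕜 E] {G : ι → Type*} [∀ i, NormedAddCommGroup (G i)]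
    [∀ i, InnerProductSpace 𝕜 (G i)] {V : ∀ i, G i →ₗᵢ[𝕜] E} :
    OrthogonalFamily 𝕜 G V ↔
      Pairwise fun i j => (V i).toLinearMap.range ⟂ (V j).toLinearMap.range := by
  simp only [Submodule.isOrtho_iff_inner_eq, LinearMap.mem_range, forall_exists_index,
    forall_apply_eq_imp_iff]
  rfl

namespace IsDoublyTwistedIsometry

variable {n : ℕ} {H : Type*} [NormedAddCommGroup H] [InnerProductSpace ℂ H] [CompleteSpace H]
  {T : Fin n → H →L[ℂ] H} {U : Fin n → Fin n → H →L[ℂ] H} (hT : IsDoublyTwistedIsometry T U)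

include hT

/-- `T_A^k` as a unitary map of `D_A` onto `T_A^k D_A`. It serves as `Λ_{A,k}`: an isometry is its
own unitary factor. -/
noncomputable def wanderingEquiv (A : Finset (Fin n)) (k : Fin A.card → ℕ) :
    wandering T A ≃ₗᵢ[ℂ] (wandering T A).map (opPow T A k).toLinearMap where
  toLinearEquiv := Submodule.equivMapOfInjective _ (hT.isometry_opPow A k).injective _
  norm_map' η := (AddMonoidHomClass.isometry_iff_norm _).1 (hT.isometry_opPow A k) η

theorem isPolarUnitary_wanderingEquiv (A : Finset (Fin n)) (k : Fin A.card → ℕ) :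
    IsPolarUnitary (opPow T A k) (wandering T A) (hT.wanderingEquiv A k) :=
  ⟨1, ContinuousLinearMap.isPositive_one, fun _ => rfl⟩

/-- `T_A^k` as an isometry of `D_A` into the whole space. -/
noncomputable def wanderingIsometry (A : Finset (Fin n)) (k : Fin A.card → ℕ) :
    wandering T A →ₗᵢ[ℂ] H :=
  (woldSpace T A k).subtypeₗᵢ.comp (hT.wanderingEquiv A k).toLinearIsometry

theorem range_wanderingIsometry (A : Finset (Fin n)) (k : Fin A.card → ℕ) :
    (hT.wanderingIsometry A k).toLinearMap.range = woldSpace T A k :=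
  (LinearMap.range_comp_of_range_eq_top _ (hT.wanderingEquiv A k).toLinearEquiv.range).trans
    (Submodule.range_subtype _)

theorem orthogonalFamily_wanderingIsometry (A : Finset (Fin n)) :
    OrthogonalFamily ℂ (fun _ : Fin A.card → ℕ => wandering T A) (hT.wanderingIsometry A) := by
  simp only [orthogonalFamily_iff_pairwise_range, range_wanderingIsometry]
  exact fun _ _ => hT.isOrtho_woldSpace

theorem completeSpace_wandering (A : Finset (Fin n)) : CompleteSpace (wandering T A) :=
  (hT.isClosed_wandering A).completeSpace_coe

/-- The isometry of `H²_{D_A}` into `H` that maps `z ^ k η` to `T_A^k η`. -/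
noncomputable def hardyIsometry (A : Finset (Fin n)) : Hardy A.card (wandering T A) →ₗᵢ[ℂ] H :=
  have := hT.completeSpace_wandering A
  (hT.orthogonalFamily_wanderingIsometry A).linearIsometry.comp Hardy.coeffEquiv.toLinearIsometry

theorem hardyIsometry_monomial (A : Finset (Fin n)) (k : Fin A.card → ℕ) (η : wandering T A) :
    hT.hardyIsometry A (Hardy.monomial k η) = opPow T A k η := by
  have := hT.completeSpace_wandering A
  change (hT.orthogonalFamily_wanderingIsometry A).linearIsometry
    (Hardy.coeffEquiv (Hardy.monomial k η)) = hT.wanderingIsometry A k η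
  rw [Hardy.coeffEquiv_monomial, OrthogonalFamily.linearIsometry_apply_single]

theorem range_hardyIsometry (A : Finset (Fin n)) :
    (hT.hardyIsometry A).toLinearMap.range = (⨆ k, woldSpace T A k).topologicalClosure := by
  have := hT.completeSpace_wandering A
  simp only [← hT.range_wanderingIsometry,
    ← (hT.orthogonalFamily_wanderingIsometry A).range_linearIsometry]
  exact LinearMap.range_comp_of_range_eq_top _ Hardy.coeffEquiv.toLinearEquiv.range

theorem orthogonalFamily_hardyIsometry :
    OrthogonalFamily ℂ (fun A : Finset (Fin n) => Hardy A.card (wandering T A))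
      hT.hardyIsometry := by
  simp only [orthogonalFamily_iff_pairwise_range, range_hardyIsometry]
  refine fun A B hAB => isOrtho_topologicalClosure ?_
  simp only [Submodule.isOrtho_iSup_left, Submodule.isOrtho_iSup_right]
  exact fun l k => hT.isOrtho_woldSpace_of_ne hAB k l

theorem isHilbertSum_hardyIsometry :
    IsHilbertSum ℂ (fun A : Finset (Fin n) => Hardy A.card (wandering T A)) hT.hardyIsometry := by
  have := hT.completeSpace_wandering
  refine IsHilbertSum.mk hT.orthogonalFamily_hardyIsometry ?_
  rw [← hT.topologicalClosure_woldSpan]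
  simp only [range_hardyIsometry]
  exact Submodule.topologicalClosure_mono
    (iSup_mono fun A => Submodule.le_topologicalClosure _)

/-- The unitary map `V` onto the model space. -/
noncomputable def modelEquiv : H ≃ₗᵢ[ℂ] ModelSpace T :=
  hT.isHilbertSum_hardyIsometry.linearIsometryEquiv.trans (lpPiLpₗᵢ _ ℂ)

theorem modelEquiv_hardyIsometry (A : Finset (Fin n)) (f : Hardy A.card (wandering T A)) :
    hT.modelEquiv (hT.hardyIsometry A f) = PiLp.single 2 A f := by
  have h : hT.isHilbertSum_hardyIsometry.linearIsometryEquiv (hT.hardyIsometry A f) =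
      lp.single 2 A f := by
    rw [← hT.isHilbertSum_hardyIsometry.linearIsometryEquiv_symm_apply_single,
      LinearIsometryEquiv.apply_symm_apply]
  change lpPiLpₗᵢ _ ℂ (hT.isHilbertSum_hardyIsometry.linearIsometryEquiv _) = _
  rw [h]
  ext B : 1
  rw [coe_lpPiLpₗᵢ, lp.single_apply]
  rfl

theorem modelEquiv_opPow (A : Finset (Fin n)) (k : Fin A.card → ℕ) (η : wandering T A) :
    hT.modelEquiv (opPow T A k η) = PiLp.single 2 A (Hardy.monomial k η) := by
  rw [← hT.hardyIsometry_monomial, hT.modelEquiv_hardyIsometry]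

/-- The component of an element of `H` in the summand of `A` of the model space. -/
noncomputable def modelComponent (A : Finset (Fin n)) : H →L[ℂ] Hardy A.card (wandering T A) :=
  PiLp.proj 2 _ A ∘L hT.modelEquiv.toContinuousLinearEquiv.toContinuousLinearMap

theorem modelComponent_opPow (A : Finset (Fin n)) (k : Fin A.card → ℕ) (η : wandering T A) :
    hT.modelComponent A (opPow T A k η) = Hardy.monomial k η := by
  change hT.modelEquiv (opPow T A k η) A = _
  rw [hT.modelEquiv_opPow, PiLp.single_eq_same]

theorem modelComponent_opPow_of_ne {A B : Finset (Fin n)} (hAB : A ≠ B) (k : Fin B.card → ℕ)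
    (η : wandering T B) : hT.modelComponent A (opPow T B k η) = 0 := by
  change hT.modelEquiv (opPow T B k η) A = _
  rw [hT.modelEquiv_opPow, PiLp.single_eq_of_ne _ hAB]

/-- The model operator `M_{A,s}`, the compression of `T s` to the summand of `A`. -/
noncomputable def modelOperator (A : Finset (Fin n)) (s : Fin n) :
    Hardy A.card (wandering T A) →L[ℂ] Hardy A.card (wandering T A) :=
  hT.modelComponent A ∘L T s ∘L (hT.hardyIsometry A).toContinuousLinearMap

theorem modelOperator_monomial {A : Finset (Fin n)} {s : Fin n} {k l : Fin A.card → ℕ}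
    {η ξ : wandering T A} (h : T s (opPow T A k η) = opPow T A l ξ) :
    hT.modelOperator A s (Hardy.monomial k η) = Hardy.monomial l ξ := by
  change hT.modelComponent A (T s (hT.hardyIsometry A (Hardy.monomial k η))) = _
  rw [hT.hardyIsometry_monomial, h, hT.modelComponent_opPow]

theorem continuousLinearMap_ext {F : Type*} [TopologicalSpace F] [T2Space F] [AddCommMonoid F]
    [Module ℂ F] {f g : H →L[ℂ] F}
    (h : ∀ A k, ∀ η ∈ wandering T A, f (opPow T A k η) = g (opPow T A k η)) : f = g := by
  have hle : woldSpan T ≤ LinearMap.eqLocus f.toLinearMap g.toLinearMap := by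
    refine iSup₂_le fun A k => ?_
    rintro _ ⟨η, hη, rfl⟩
    exact h A k η hη
  have hdense : Dense (woldSpan T : Set H) :=
    Submodule.dense_iff_topologicalClosure_eq_top.2 hT.topologicalClosure_woldSpan
  exact ContinuousLinearMap.coeFn_injective (f.continuous.ext_on hdense g.continuous hle)

theorem modelComponent_comp (A : Finset (Fin n)) (s : Fin n) :
    hT.modelComponent A ∘L T s = hT.modelOperator A s ∘L hT.modelComponent A := by
  refine hT.continuousLinearMap_ext fun B k η hη => ?_
  obtain ⟨l, hl⟩ := hT.exists_map_woldSpace_eq s B k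
  obtain ⟨ξ, hξ, hTη⟩ : T s (opPow T B k η) ∈ woldSpace T B l :=
    hl.le (Submodule.mem_map_of_mem (Submodule.mem_map_of_mem hη))
  lift η to wandering T B using hη
  lift ξ to wandering T B using hξ
  change hT.modelComponent A (T s (opPow T B k η)) =
    hT.modelOperator A s (hT.modelComponent A (opPow T B k η))
  rw [← hTη]
  rcases eq_or_ne A B with rfl | hAB
  · rw [hT.modelComponent_opPow, hT.modelOperator_monomial hTη.symm]
    exact hT.modelComponent_opPow A l ξ
  · rw [hT.modelComponent_opPow_of_ne hAB, map_zero]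
    exact hT.modelComponent_opPow_of_ne hAB l ξ

end IsDoublyTwistedIsometry

end Model

theorem mainTheorem8 {n : ℕ} (hn : 2 ≤ n) {H : Type*} [NormedAddCommGroup H]
    [InnerProductSpace ℂ H] [CompleteSpace H] (T : Fin n → H →L[ℂ] H)
    (U : Fin n → Fin n → H →L[ℂ] H) (hT : IsDoublyTwistedIsometry T U) :
    -- the weights map each wandering subspace into itself
    ∃ (hshift : ∀ (A : Finset (Fin n)) (i : Fin A.card) (k : Fin A.card → ℕ),
          ∀ η ∈ wandering T A, shiftWeight U A i k η ∈ wandering T A)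
      (hdiag : ∀ (A : Finset (Fin n)) (q : Fin n), q ∉ A → ∀ k : Fin A.card → ℕ,
          ∀ η ∈ wandering T A, diagWeight T U A q k η ∈ wandering T A)
      (Λ : ∀ (A : Finset (Fin n)) (k : Fin A.card → ℕ),
          wandering T A ≃ₗᵢ[ℂ] (wandering T A).map (opPow T A k).toLinearMap)
      (M : ∀ A : Finset (Fin n), Fin n →
          (Hardy A.card (wandering T A) →L[ℂ] Hardy A.card (wandering T A)))
      (V : H ≃ₗᵢ[ℂ] ModelSpace T),
      -- the unitaries coming from the polar decompositions, and the weights they define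
      (∀ A k, IsPolarUnitary (opPow T A k) (wandering T A) (Λ A k)) ∧
      (∀ A i k (η : wandering T A), T (elt A i) (Λ A k η) =
        Λ A (k + Pi.single i 1) ⟨shiftWeight U A i k η, hshift A i k η η.2⟩) ∧
      (∀ A q (hq : q ∉ A) k (η : wandering T A), T q (Λ A k η) =
        Λ A k ⟨diagWeight T U A q k η, hdiag A q hq k η η.2⟩) ∧
      -- the model operators on monomials
      (∀ A i k (η : wandering T A), M A (elt A i) (Hardy.monomial k η) =
        Hardy.monomial (k + Pi.single i 1) ⟨shiftWeight U A i k η, hshift A i k η η.2⟩) ∧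
      (∀ A q (hq : q ∉ A) k (η : wandering T A), M A q (Hardy.monomial k η) =
        Hardy.monomial k ⟨diagWeight T U A q k η, hdiag A q hq k η η.2⟩) ∧
      -- the unitary equivalence of `T` with the direct sums of the model operators
      (∀ A k (η : wandering T A),
        V (Λ A k η) = PiLp.single 2 A (Hardy.monomial k η)) ∧
      ∀ s x A, V (T s x) A = M A s (V x A) := by
  have hshift : ∀ (A : Finset (Fin n)) (i : Fin A.card) (k : Fin A.card → ℕ),
      ∀ η ∈ wandering T A, shiftWeight U A i k η ∈ wandering T A :=
    fun A i k _ hη => (map_wandering (hT.shiftWeight_mem A i k)).le (Submodule.mem_map_of_mem hη)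
  have hdiag : ∀ (A : Finset (Fin n)) (q : Fin n), q ∉ A → ∀ k : Fin A.card → ℕ,
      ∀ η ∈ wandering T A, diagWeight T U A q k η ∈ wandering T A :=
    fun A q hq k _ hη => (hT.map_diagWeight_wandering hq k).le (Submodule.mem_map_of_mem hη)
  have hmem (A i k) (η : wandering T A) : T (elt A i) (opPow T A k η) =
      opPow T A (k + Pi.single i 1) (shiftWeight U A i k η) :=
    DFunLike.congr_fun (hT.mul_opPow_of_mem A i k) (η : H)
  have hnotMem (A q) (hq : q ∉ A) (k) (η : wandering T A) : T q (opPow T A k η) =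
      opPow T A k (diagWeight T U A q k η) :=
    DFunLike.congr_fun (hT.mul_opPow_of_notMem hq k) (η : H)
  exact ⟨hshift, hdiag, hT.wanderingEquiv, hT.modelOperator, hT.modelEquiv,
    hT.isPolarUnitary_wanderingEquiv, hmem, hnotMem,
    fun A i k η => hT.modelOperator_monomial (hmem A i k η),
    fun A q hq k η => hT.modelOperator_monomial (hnotMem A q hq k η),
    hT.modelEquiv_opPow,
    fun s x A => DFunLike.congr_fun (hT.modelComponent_comp A s) x⟩
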